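/- Let $\mathbb N=\{1,2,3,\dots\}$ and let $k\ge 2$ be an even integer. For an infinite set $X=\{x_1<x_2<\cdots\}\subseteq\mathbb N$ and a set $J=\{j_1<\cdots<j_k\}\subseteq\mathbb N$ put $$\sum^*_{j\in J}x_j = x_{j_k}-x_{j_{k-1}}+x_{j_{k-2}}-x_{j_{k-3}}+\cdots+x_{j_2}-x_{j_1},\qquad X^*_{alt}=\Big\{\sum^*_{j\in J}x_j : J\in\tbinom{\mathbb N}{k}\Big\}.$$ For a coloring $\Delta\colon\mathbb N\to\mathbb N$, a set $S\subseteq\mathbb N$ is monochromatic if all its elements have the same color, and rainbow if distinct elements of $S$ have distinct colors. Consider the following patterns for $X$ and $\Delta$: (i) $X\cup X^*_{alt}$ is monochromatic; (ii) $X\cup X^*_{alt}$ is rainbow; (iii) $X$ is rainbow and $\Delta(\sum^*_{j\in J}x_j)=\Delta(x_{\max J})$ for all $J\in\binom{\mathbb N}{k}$; (iv) $X$ is monochromatic, $\Delta(X)\cap\Delta(X^*_{alt})=\emptyset$, and for all $I,J\in\binom{\mathbb N}{k}$: $\Delta(\sum^*_{j\in J}x_j)=\Delta(\sum^*_{j\in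 I}x_j)$ if and only if $\min I=\min J$; (v) $X$ is rainbow, $\Delta(X)\cap\Delta(X^*_{alt})=\emptyset$, and for all $I,J\in\binom{\mathbb N}{k}$: $\Delta(\sum^*_{j\in J}x_j)=\Delta(\sum^*_{j\in I}x_j)$ if and only if $\min I=\min J$ and $\max I=\max J$. Then for every coloring $\Delta\colon\mathbb N\to\mathbb N$ there is an infinite set $X=\{x_1<x_2<\cdots\}\subseteq\mathbb N$ following at least one of the patterns (i)–(v); moreover $X$ can be chosen so that the numbers $x_i$ ($i\in\mathbb N$) and $\sum^*_{j\in J}x_j$ ($J\in\binom{\mathbb N}{k}$) are pairwise distinct. If $k\ge4$, none of the five patterns can be omitted: for each of them there is a coloring of $\mathbb N$ for which no infinite $X$ follows any of the other four. If $k=2$, patterns (ii) and (v) coincide whenever the numbers $x_i$ and $\sum^*_{j\in J}x_j$ are pairwise distinct; more precisely, for every $\Delta$ and every infinite $X$, pattern (v) holds if and only if pattern (ii) holds and these numbers are pairwise distinct. For $k=2$ none of the four patterns (i)–(iv) can be omitted: for each of them there is a coloring of $\mathbb N$ for which no infinite $X$ follows any of the other three. -/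

import Mathlib

namespace AltSum

/-- A strictly increasing sequence of positive integers, i.e. the enumeration
`x 0 < x 1 < x 2 < ⋯` of an infinite set `X = Set.range x` of positive integers. -/
def IsSeq (x : ℕ → ℕ) : Prop :=
  StrictMono x ∧ ∀ i, 0 < x i

/-- The alternating sum `x_{j_k} - x_{j_{k-1}} + x_{j_{k-2}} - ⋯` over
`J = {j_1 < ⋯ < j_k}`, as an integer: the term of `j ∈ J` has the sign `(-1) ^ r`, where `r` is
the number of elements of `J` above `j`. -/
def altSumInt (x : ℕ → ℕ) (J : Finset ℕ) : ℤ :=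
  ∑ j ∈ J, (-1) ^ (J.filter (fun i => j < i)).card * (x j : ℤ)

/-- The alternating sum as a natural number; nothing is lost, see `altSum_cast`. -/
def altSum (x : ℕ → ℕ) (J : Finset ℕ) : ℕ :=
  (altSumInt x J).toNat

theorem altSumInt_insert (x : ℕ → ℕ) (m : ℕ) (J : Finset ℕ) (h : ∀ j ∈ J, j < m) :
    altSumInt x (insert m J) = x m - altSumInt x J := by
  have hm : m ∉ J := fun hJ => lt_irrefl _ (h m hJ)
  have h0 : (insert m J).filter (fun i => m < i) = ∅ := by
    ext i
    simp only [Finset.mem_filter, Finset.mem_insert, Finset.notMem_empty, iff_false, not_and]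
    rintro (rfl | hi)
    · exact lt_irrefl _
    · exact (h i hi).asymm
  have h1 : ∀ j ∈ J, (-1 : ℤ) ^ ((insert m J).filter (fun i => j < i)).card * (x j : ℤ)
      = -((-1) ^ (J.filter (fun i => j < i)).card * (x j : ℤ)) := by
    intro j hj
    rw [Finset.filter_insert, if_pos (h j hj), Finset.card_insert_of_notMem (by simp [hm])]
    ring
  unfold altSumInt
  rw [Finset.sum_insert hm, h0, Finset.sum_congr rfl h1, Finset.sum_neg_distrib]
  simp [sub_eq_add_neg]

theorem altSumInt_bounds {x : ℕ → ℕ} (hx : IsSeq x) (J : Finset ℕ) :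
    (J.Nonempty → 0 < altSumInt x J) ∧ 0 ≤ altSumInt x J ∧
      ∀ M, (∀ j ∈ J, j < M) → altSumInt x J < x M := by
  induction J using Finset.induction_on_max with
  | empty => simpa [altSumInt] using hx.2
  | insert m J h ih =>
    obtain ⟨-, h0, hlt⟩ := ih
    have hm := hlt m h
    rw [altSumInt_insert x m J h]
    refine ⟨fun _ => by linarith, by linarith, fun M hM => ?_⟩
    have h2 : (x m : ℤ) < x M := by exact_mod_cast hx.1 (hM m (Finset.mem_insert_self m J))
    linarith

/-- The alternating sums that occur are positive integers, so `altSum` does not truncate. -/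
theorem altSum_cast {x : ℕ → ℕ} (hx : IsSeq x) {J : Finset ℕ} (hJ : J.Nonempty) :
    (altSum x J : ℤ) = altSumInt x J ∧ 0 < altSum x J := by
  have h := (altSumInt_bounds hx J).1 hJ
  unfold altSum
  omega

/-- The set of the alternating sums over all `k`-element index sets. -/
def altSums (k : ℕ) (x : ℕ → ℕ) : Set ℕ :=
  {n | ∃ J : Finset ℕ, J.card = k ∧ altSum x J = n}

/-- All elements of `S` have the same color. -/
def Monochromatic (Δ : ℕ → ℕ) (S : Set ℕ) : Prop :=
  ∀ a ∈ S, ∀ b ∈ S, Δ a = Δ b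

/-- Distinct elements of `S` have distinct colors. -/
def Rainbow (Δ : ℕ → ℕ) (S : Set ℕ) : Prop :=
  Set.InjOn Δ S

/-- Names of the five patterns (i), (ii), (iii), (iv), (v), in this order. -/
inductive Pattern : Type
  | mono
  | rainbow
  | byMax
  | byMin
  | byMinMax

/-- `Follows k Δ x p`: the set `X = Set.range x` and its set of `k`-term alternating sums are
colored by `Δ` according to the pattern `p`. -/
def Follows (k : ℕ) (Δ : ℕ → ℕ) (x : ℕ → ℕ) : Pattern → Prop
  | .mono => Monochromatic Δ (Set.range x ∪ altSums k x)
  | .rainbow => Rainbow Δ (Set.range x ∪ altSums k x)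
  | .byMax =>
      Rainbow Δ (Set.range x) ∧
      ∀ J : Finset ℕ, J.card = k → ∀ m : ℕ, J.max = (m : WithBot ℕ) →
        Δ (altSum x J) = Δ (x m)
  | .byMin =>
      Monochromatic Δ (Set.range x) ∧
      (Δ '' Set.range x) ∩ (Δ '' altSums k x) = ∅ ∧
      ∀ I J : Finset ℕ, I.card = k → J.card = k →
        (Δ (altSum x J) = Δ (altSum x I) ↔ I.min = J.min)
  | .byMinMax =>
      Rainbow Δ (Set.range x) ∧
      (Δ '' Set.range x) ∩ (Δ '' altSums k x) = ∅ ∧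
      ∀ I J : Finset ℕ, I.card = k → J.card = k →
        (Δ (altSum x J) = Δ (altSum x I) ↔ I.min = J.min ∧ I.max = J.max)

/-- The patterns of `S` suffice: for every coloring some infinite set of positive integers
follows one of them. -/
def Unavoidable (k : ℕ) (S : Set Pattern) : Prop :=
  ∀ Δ : ℕ → ℕ, ∃ x : ℕ → ℕ, IsSeq x ∧ ∃ p ∈ S, Follows k Δ x p

/-- The terms `x i` and the alternating sums over the `k`-element index sets are pairwise
distinct numbers. -/
def PairwiseDistinct (k : ℕ) (x : ℕ → ℕ) : Prop :=
  Function.Injective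
    (Sum.elim x (fun J : {J : Finset ℕ // J.card = k} => altSum x J.1))

end AltSum

/-!
Taylor's canonical form of Hindman's theorem (`AltSum.exists_canonical`) provides positive integers
`y 0, y 1, …` such that the color of a finite sum of distinct terms is constant, or encodes exactly
its first index, its last index, the pair of both, or its whole index set. Put
`x i = y 0 + ⋯ + y i`. As `k` is even, the alternating sum over `J` is the sum of `y` over a union
of `k / 2` intervals of indices, the first of which starts at `min J + 1` and the last of which ends
at `max J`, while `x i` belongs to the index set `{0, …, i}`. So the five cases become the five
patterns, and since the `y n` grow fast, distinct index sets give distinct numbers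
(`AltSum.exists_follows`).

For the canonical theorem fix an idempotent ultrafilter `U` and choose `y` generic for `U`: every
relevant property holds for `y n`, with sums of earlier terms as parameters, if and only if it holds
for `U`-almost all numbers (`AltSum.exists_generic`). Then three yes-or-no questions about almost
all `z`, `w`, `u` decide the case: is `Δ (z + w) = Δ z`, is `Δ (z + u) = Δ u`, and is
`Δ (z + w + u) = Δ (z + u)`? A positive answer says that a last, first, or middle summand does not
matter. After a negative answer, no accidental equality of colors is possible: it would persist for
almost all values of the summand in question, and also with this summand split in two, and comparing
the two equalities turns the answer positive.

Conversely, each pattern is the only possible one for some coloring: a constant coloring, the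
identity, the binary logarithm, the 2-adic valuation, and the pair of the last two. For the
logarithm, sums with a fixed large last term take at most two colors, so two of any three agree; for
the valuation, terms agreeing modulo a large power of two cancel in pairs, and terms divisible by
such a power do not count. For `k = 2` an index set is determined by its minimum and maximum, so the
patterns `byMinMax` and `rainbow` both say that distinct terms and sums have distinct colors.
-/

namespace AltSum

open Filter Finset

/-! ### Sequences generic for an idempotent ultrafilter -/

/-- `U + U = U` in `βℕ`, spelled out as a rule for the quantifier "for `U`-almost all". -/
def IsIdempotent (U : Ultrafilter ℕ) : Prop :=
  ∀ p : ℕ → Prop, (∀ᶠ n in U, p n) ↔ ∀ᶠ m in U, ∀ᶠ n in U, p (m + n)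

attribute [local instance] Ultrafilter.add Ultrafilter.addSemigroup in
theorem exists_isIdempotent :
    ∃ U : Ultrafilter ℕ, IsIdempotent U ∧ ∀ N : ℕ, ∀ᶠ n in U, N < n := by
  obtain ⟨U, hU, h⟩ := Hindman.exists_idempotent_ultrafilter_le_FS (Stream'.const 1 : Stream' ℕ)
  have hid : IsIdempotent U := fun p => by
    conv_lhs => rw [← hU]
    exact Ultrafilter.eventually_add U U p
  refine ⟨U, hid, fun N => ?_⟩
  have hpos : ∀ n, n ∈ Hindman.FS (Stream'.const 1 : Stream' ℕ) → 0 < n := by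
    intro n hn
    generalize ha : (Stream'.const 1 : Stream' ℕ) = a at hn
    induction hn with
    | head' a => subst ha; exact Nat.one_pos
    | tail' a m _ ih => subst ha; exact ih rfl
    | cons' a m _ ih => subst ha; exact Nat.add_pos_right _ (ih rfl)
  have h0 : ∀ᶠ n in U, 0 < n := h.mono hpos
  induction N with
  | zero => exact h0
  | succ N ih =>
    rw [hid]
    filter_upwards [ih] with m hm
    filter_upwards [h0] with n hn
    omega

section Generic

variable {U : Ultrafilter ℕ} {y : ℕ → ℕ}

/-- Each term `y n` satisfies `C`, with the sums of earlier terms as parameters, exactly when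
`U`-almost all numbers do. -/
def Generic (U : Ultrafilter ℕ) (y : ℕ → ℕ) (C : ℕ → ℕ → ℕ → Prop) : Prop :=
  ∀ n, ∀ S ⊆ range n, ∀ T ⊆ range n,
    (C (∑ i ∈ S, y i) (∑ i ∈ T, y i) (y n) ↔ ∀ᶠ z in U, C (∑ i ∈ S, y i) (∑ i ∈ T, y i) z)

/-- If `R s t z` holds for almost all `z`, whatever `s` and `t` are, some sequence satisfies `R`
with all sums of earlier terms as parameters: each term avoids finitely many null sets. -/
theorem exists_seq_subset_sums (R : ℕ → ℕ → ℕ → Prop) (hR : ∀ s t, ∀ᶠ z in U, R s t z) :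
    ∃ y : ℕ → ℕ, ∀ n, ∀ S ⊆ range n, ∀ T ⊆ range n,
      R (∑ i ∈ S, y i) (∑ i ∈ T, y i) (y n) := by
  have h : ∀ F : Finset ℕ, ∃ z, ∀ s ∈ F, ∀ t ∈ F, R s t z := fun F =>
    (((F.eventually_all (l := (U : Filter ℕ))).2 fun s _ =>
      (F.eventually_all (l := (U : Filter ℕ))).2 fun t _ => hR s t)).exists
  choose g hg using h
  -- `F n` collects the sums of the first `n` terms over all index sets.
  let F : ℕ → Finset ℕ := fun n =>
    Nat.rec {0} (fun _ G => G ∪ G.image (· + g G)) n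
  have hF : ∀ n, F (n + 1) = F n ∪ (F n).image (· + g (F n)) := fun n => rfl
  refine ⟨fun n => g (F n), ?_⟩
  have key : ∀ n, ∀ S ⊆ range n, ∑ i ∈ S, g (F i) ∈ F n := by
    intro n
    induction n with
    | zero =>
      intro S hS
      rw [range_zero, subset_empty] at hS
      simp [hS, F]
    | succ n ih =>
      intro S hS
      rw [range_add_one] at hS
      rw [hF, mem_union, mem_image]
      by_cases hn : n ∈ S
      · right
        exact ⟨_, ih _ (subset_insert_iff.1 hS), sum_erase_add _ _ hn⟩
      · left
        exact ih _ ((subset_insert_iff_of_notMem hn).1 hS)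
  exact fun n S hS T hT => hg _ _ (key n S hS) _ (key n T hT)

theorem exists_generic (hU : ∀ N : ℕ, ∀ᶠ n in U, N < n) (L : List (ℕ → ℕ → ℕ → Prop)) :
    ∃ y : ℕ → ℕ, (∀ n, ∀ S ⊆ range n, ∑ i ∈ S, y i < y n) ∧ ∀ C ∈ L, Generic U y C := by
  obtain ⟨y, hy⟩ := exists_seq_subset_sums (U := U)
    (fun s t z => s < z ∧ ∀ C ∈ L, (C s t z ↔ ∀ᶠ w in U, C s t w)) (fun s t => by
      refine (hU s).and ?_
      induction L with
      | nil => simp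
      | cons C L ih =>
        simp only [List.mem_cons, forall_eq_or_imp]
        refine Filter.Eventually.and ?_ ih
        by_cases h : ∀ᶠ w in U, C s t w
        · filter_upwards [h] with z hz
          exact iff_of_true hz h
        · filter_upwards [Ultrafilter.eventually_not.2 h] with z hz
          exact iff_of_false hz h)
  exact ⟨y, fun n S hS => (hy n S hS S hS).1, fun C hC n S hS T hT => (hy n S hS T hT).2 C hC⟩

/-- For a generic sequence, translating by a sum of terms does not change whether a property holds
almost everywhere. -/
theorem Generic.eventually_add_iff {P : ℕ → Prop} (hU : IsIdempotent U)
    (h : Generic U y fun s _ w => ∀ᶠ z in U, P (s + w + z)) (S : Finset ℕ) :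
    (∀ᶠ z in U, P (∑ i ∈ S, y i + z)) ↔ ∀ᶠ z in U, P z := by
  induction S using Finset.induction_on_max with
  | empty => simp
  | insert m S hm ih =>
    have hS : S ⊆ range m := fun i hi => mem_range.2 (hm i hi)
    rw [sum_insert (fun h => lt_irrefl _ (hm m h)), add_comm (y m), ← ih]
    have e := hU fun z => P (∑ i ∈ S, y i + z)
    simp only [← add_assoc] at e
    exact (h m S hS S hS).trans e.symm

/-- All finite sums of a generic sequence have the properties of almost all numbers. This is the
mechanism of Hindman's theorem. -/
theorem Generic.sum_iff {P : ℕ → Prop} (hU : IsIdempotent U)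
    (h : Generic U y fun s _ w => ∀ᶠ z in U, P (s + w + z))
    (h' : Generic U y fun s _ w => P (s + w)) {S : Finset ℕ} (hS : S.Nonempty) :
    P (∑ i ∈ S, y i) ↔ ∀ᶠ z in U, P z := by
  induction S using Finset.induction_on_max with
  | empty => simp at hS
  | insert m S hm _ =>
    have hS : S ⊆ range m := fun i hi => mem_range.2 (hm i hi)
    rw [sum_insert (fun h => lt_irrefl _ (hm m h)), add_comm (y m), ← h.eventually_add_iff hU S]
    exact h' m S hS S hS

end Generic

/-! ### The canonical theorem for finite sums -/

section Canonical

variable {U : Ultrafilter ℕ} {Δ : ℕ → ℕ} {y : ℕ → ℕ}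

/-- `s` and `t` are equivalent if adding `U`-almost any number to both gives equal colors. -/
def ColorEquiv (U : Ultrafilter ℕ) (Δ : ℕ → ℕ) (s t : ℕ) : Prop :=
  ∀ᶠ u in U, Δ (s + u) = Δ (t + u)

theorem ColorEquiv.refl (s : ℕ) : ColorEquiv U Δ s s := Eventually.of_forall fun _ => rfl

theorem ColorEquiv.symm {s t : ℕ} (h : ColorEquiv U Δ s t) : ColorEquiv U Δ t s :=
  h.mono fun _ => Eq.symm

theorem ColorEquiv.trans {s t r : ℕ} (h : ColorEquiv U Δ s t) (h' : ColorEquiv U Δ t r) :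
    ColorEquiv U Δ s r := by
  filter_upwards [h, h'] with u hu hu' using hu.trans hu'

theorem IsIdempotent.equiv_iff (hU : IsIdempotent U) {s t : ℕ} :
    ColorEquiv U Δ s t ↔ ∀ᶠ z in U, ColorEquiv U Δ (s + z) (t + z) := by
  simp only [ColorEquiv, add_assoc]
  exact hU fun u => Δ (s + u) = Δ (t + u)

/-- Adding almost any number to `s` does not affect its color. -/
def AbsorbsRight (U : Ultrafilter ℕ) (Δ : ℕ → ℕ) (s : ℕ) : Prop :=
  ∀ᶠ w in U, Δ (s + w) = Δ s

/-- Inserting a summand between `s` and a later summand does not affect the color, for almost all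
choices of the two. -/
def AbsorbsMiddle (U : Ultrafilter ℕ) (Δ : ℕ → ℕ) (s : ℕ) : Prop :=
  ∀ᶠ w in U, ColorEquiv U Δ s (s + w)

/-- The predicates to which the sequence has to be generic for the proof of the canonical
theorem. -/
def predicates (U : Ultrafilter ℕ) (Δ : ℕ → ℕ) : List (ℕ → ℕ → ℕ → Prop) :=
  [fun s t z => Δ (s + z) = Δ t,
    fun s t z => Δ (s + z) = Δ (t + z),
    fun s t z => ColorEquiv U Δ (s + z) t,
    fun s t z => ColorEquiv U Δ (s + z) (t + z),
    fun s _ w => ∀ᶠ z in U, AbsorbsRight U Δ (s + w + z),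
    fun s _ w => AbsorbsRight U Δ (s + w),
    fun s _ w => ∀ᶠ z in U, ColorEquiv U Δ (s + w + z) 0,
    fun s _ w => ColorEquiv U Δ (s + w) 0,
    fun s _ w => ∀ᶠ z in U, AbsorbsMiddle U Δ (s + w + z),
    fun s _ w => AbsorbsMiddle U Δ (s + w)]

theorem subset_range_of_insert {S : Finset ℕ} {n : ℕ} (hS : S ⊆ range (n + 1)) :
    S ⊆ range n ∨ ∃ S' ⊆ range n, n ∉ S' ∧ S = insert n S' := by
  rw [range_add_one] at hS
  by_cases hn : n ∈ S
  · exact Or.inr ⟨S.erase n, subset_insert_iff.1 hS, notMem_erase n S, (insert_erase hn).symm⟩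
  · exact Or.inl ((subset_insert_iff_of_notMem hn).1 hS)

theorem subset_range_of_mem_max {S : Finset ℕ} {n : ℕ} (hS : S.max = (n : WithBot ℕ)) :
    ∃ S' ⊆ range n, n ∉ S' ∧ S = insert n S' := by
  have hn := mem_of_max hS
  refine ⟨S.erase n, fun i hi => ?_, notMem_erase n S, (insert_erase hn).symm⟩
  rw [mem_erase] at hi
  exact mem_range.2 (lt_of_le_of_ne (le_max_of_eq hi.2 hS) hi.1)

theorem sum_insert_last {S : Finset ℕ} {n : ℕ} (hn : n ∉ S) (y : ℕ → ℕ) :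
    ∑ i ∈ insert n S, y i = ∑ i ∈ S, y i + y n := by
  rw [sum_insert hn, add_comm]

theorem min_insert_last {S : Finset ℕ} {n : ℕ} (hS : S ⊆ range n) (hne : S.Nonempty) :
    (insert n S).min = S.min := by
  obtain ⟨a, ha⟩ := min_of_nonempty hne
  rw [min_insert, ha]
  exact min_eq_right (WithTop.coe_le_coe.2 (mem_range.1 (hS (mem_of_min ha))).le)

theorem max_insert_last {S : Finset ℕ} {n : ℕ} (hS : S ⊆ range n) :
    (insert n S).max = (n : WithBot ℕ) := by
  rw [max_insert]
  exact max_eq_left (Finset.max_le fun a ha => WithBot.coe_le_coe.2 (mem_range.1 (hS ha)).le)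

theorem exists_subset_range (S : Finset ℕ) : ∃ n, S ⊆ range n :=
  ⟨S.sup id + 1, fun _ hi => mem_range.2 (Nat.lt_succ_of_le (le_sup (f := id) hi))⟩

theorem exists_subset_range₂ (S T : Finset ℕ) : ∃ n, S ⊆ range n ∧ T ⊆ range n := by
  obtain ⟨n, hn⟩ := exists_subset_range (S ∪ T)
  exact ⟨n, union_subset_iff.1 hn⟩


/-- The setting of the canonical theorem: `U` is idempotent and `y` is generic for all the predicates
in `predicates U Δ`. -/
structure GenericSeq (U : Ultrafilter ℕ) (Δ : ℕ → ℕ) (y : ℕ → ℕ) : Prop where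
  idem : IsIdempotent U
  generic : ∀ C ∈ predicates U Δ, Generic U y C

namespace GenericSeq

theorem color_eq_const_iff (h : GenericSeq U Δ y) {n : ℕ} {S T : Finset ℕ} (hS : S ⊆ range n)
    (hT : T ⊆ range n) : Δ (∑ i ∈ S, y i + y n) = Δ (∑ i ∈ T, y i) ↔
      ∀ᶠ z in U, Δ (∑ i ∈ S, y i + z) = Δ (∑ i ∈ T, y i) :=
  h.generic (fun s t z => Δ (s + z) = Δ t) (by simp [predicates]) n S hS T hT

theorem color_eq_iff (h : GenericSeq U Δ y) {n : ℕ} {S T : Finset ℕ} (hS : S ⊆ range n)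
    (hT : T ⊆ range n) : Δ (∑ i ∈ S, y i + y n) = Δ (∑ i ∈ T, y i + y n) ↔
      ColorEquiv U Δ (∑ i ∈ S, y i) (∑ i ∈ T, y i) :=
  h.generic (fun s t z => Δ (s + z) = Δ (t + z)) (by simp [predicates]) n S hS T hT

theorem equiv_const_iff (h : GenericSeq U Δ y) {n : ℕ} {S T : Finset ℕ} (hS : S ⊆ range n)
    (hT : T ⊆ range n) : ColorEquiv U Δ (∑ i ∈ S, y i + y n) (∑ i ∈ T, y i) ↔
      ∀ᶠ z in U, ColorEquiv U Δ (∑ i ∈ S, y i + z) (∑ i ∈ T, y i) :=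
  h.generic (fun s t z => ColorEquiv U Δ (s + z) t) (by simp [predicates]) n S hS T hT

theorem equiv_add_iff (h : GenericSeq U Δ y) {n : ℕ} {S T : Finset ℕ} (hS : S ⊆ range n)
    (hT : T ⊆ range n) : ColorEquiv U Δ (∑ i ∈ S, y i + y n) (∑ i ∈ T, y i + y n) ↔
      ColorEquiv U Δ (∑ i ∈ S, y i) (∑ i ∈ T, y i) :=
  (h.generic (fun s t z => ColorEquiv U Δ (s + z) (t + z)) (by simp [predicates]) n S hS T hT).trans
    h.idem.equiv_iff.symm

theorem absorbsRight_iff (h : GenericSeq U Δ y) {S : Finset ℕ} (hS : S.Nonempty) :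
    AbsorbsRight U Δ (∑ i ∈ S, y i) ↔ ∀ᶠ z in U, AbsorbsRight U Δ z :=
  Generic.sum_iff h.idem (h.generic _ (by simp [predicates]))
    (h.generic _ (by simp [predicates])) hS

theorem eventually_absorbsRight_iff (h : GenericSeq U Δ y) (S : Finset ℕ) :
    (∀ᶠ z in U, AbsorbsRight U Δ (∑ i ∈ S, y i + z)) ↔ ∀ᶠ z in U, AbsorbsRight U Δ z :=
  Generic.eventually_add_iff h.idem (h.generic _ (by simp [predicates])) S

theorem equiv_zero_iff (h : GenericSeq U Δ y) {S : Finset ℕ} (hS : S.Nonempty) :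
    ColorEquiv U Δ (∑ i ∈ S, y i) 0 ↔ ∀ᶠ z in U, ColorEquiv U Δ z 0 :=
  Generic.sum_iff (P := fun s => ColorEquiv U Δ s 0) h.idem (h.generic _ (by simp [predicates]))
    (h.generic _ (by simp [predicates])) hS

theorem absorbsMiddle_iff (h : GenericSeq U Δ y) {S : Finset ℕ} (hS : S.Nonempty) :
    AbsorbsMiddle U Δ (∑ i ∈ S, y i) ↔ ∀ᶠ z in U, AbsorbsMiddle U Δ z :=
  Generic.sum_iff h.idem (h.generic _ (by simp [predicates]))
    (h.generic _ (by simp [predicates])) hS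

theorem eventually_absorbsMiddle_iff (h : GenericSeq U Δ y) (S : Finset ℕ) :
    (∀ᶠ z in U, AbsorbsMiddle U Δ (∑ i ∈ S, y i + z)) ↔ ∀ᶠ z in U, AbsorbsMiddle U Δ z :=
  Generic.eventually_add_iff h.idem (h.generic _ (by simp [predicates])) S

/-- If numbers do not absorb later ones, no color of a sum is attained by earlier sums: a color
attained by `s + z` for almost all `z` would be the color of `s + z` and of `s + z + w`. -/
theorem color_ne_of_not_absorbsRight (h : GenericSeq U Δ y)
    (h1 : ¬ ∀ᶠ z in U, AbsorbsRight U Δ z) {n : ℕ} {S T : Finset ℕ} (hS : S ⊆ range n)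
    (hT : T ⊆ range n) : Δ (∑ i ∈ S, y i + y n) ≠ Δ (∑ i ∈ T, y i) := by
  rw [Ne, h.color_eq_const_iff hS hT]
  intro hc
  rw [← h.eventually_absorbsRight_iff S] at h1
  refine h1 ?_
  have hc' := (h.idem fun z => Δ (∑ i ∈ S, y i + z) = Δ (∑ i ∈ T, y i)).1 hc
  filter_upwards [hc, hc'] with z hz hz'
  filter_upwards [hz'] with w hw
  rw [hz, add_assoc, hw]

/-- Under right absorption the color of a sum is determined by its first term. -/
theorem color_eq_of_absorbsRight (h : GenericSeq U Δ y) (h1 : ∀ᶠ z in U, AbsorbsRight U Δ z)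
    {S : Finset ℕ} {a : ℕ} (ha : S.min = (a : WithTop ℕ)) : Δ (∑ i ∈ S, y i) = Δ (y a) := by
  induction S using Finset.induction_on_max with
  | empty => simp at ha
  | insert m S hm ih =>
    have hS : S ⊆ range m := fun i hi => mem_range.2 (hm i hi)
    have hmS : m ∉ S := fun h => lt_irrefl _ (hm m h)
    obtain rfl | hne := S.eq_empty_or_nonempty
    · simp at ha
      simp [ha]
    · rw [min_insert_last hS hne] at ha
      rw [sum_insert_last hmS, ← ih ha, h.color_eq_const_iff hS hS]
      exact (h.absorbsRight_iff hne).2 h1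

/-- If almost all numbers are equivalent to `0`, the last term of a sum determines its color. -/
theorem color_eq_of_equiv_zero (h : GenericSeq U Δ y) (h2 : ∀ᶠ z in U, ColorEquiv U Δ z 0)
    {S : Finset ℕ} {b : ℕ} (hb : S.max = (b : WithBot ℕ)) : Δ (∑ i ∈ S, y i) = Δ (y b) := by
  obtain ⟨S, hS, hbS, rfl⟩ := subset_range_of_mem_max hb
  rw [sum_insert_last hbS]
  have := (h.color_eq_iff hS (empty_subset _)).2 (by
    obtain rfl | hne := S.eq_empty_or_nonempty
    · exact ColorEquiv.refl _
    · simpa using (h.equiv_zero_iff hne).2 h2)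
  simpa using this

/-- Under middle absorption a sum is equivalent to its first term. -/
theorem equiv_of_absorbsMiddle (h : GenericSeq U Δ y) (h3 : ∀ᶠ z in U, AbsorbsMiddle U Δ z)
    {S : Finset ℕ} {a : ℕ} (ha : S.min = (a : WithTop ℕ)) :
    ColorEquiv U Δ (∑ i ∈ S, y i) (y a) := by
  induction S using Finset.induction_on_max with
  | empty => simp at ha
  | insert m S hm ih =>
    have hS : S ⊆ range m := fun i hi => mem_range.2 (hm i hi)
    have hmS : m ∉ S := fun h => lt_irrefl _ (hm m h)
    obtain rfl | hne := S.eq_empty_or_nonempty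
    · simp at ha
      simpa [ha] using ColorEquiv.refl _
    · rw [min_insert_last hS hne] at ha
      rw [sum_insert_last hmS]
      refine ColorEquiv.trans ((h.equiv_const_iff hS hS).2 ?_) (ih ha)
      exact ((h.absorbsMiddle_iff hne).2 h3).mono fun _ => ColorEquiv.symm

/-- A fixed number equivalent to `s + z` for almost all `z` forces middle absorption. -/
theorem eventually_absorbsMiddle_of_equiv_const (h : GenericSeq U Δ y) {S : Finset ℕ} {t : ℕ}
    (hc : ∀ᶠ z in U, ColorEquiv U Δ (∑ i ∈ S, y i + z) t) : ∀ᶠ z in U, AbsorbsMiddle U Δ z := by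
  rw [← h.eventually_absorbsMiddle_iff S]
  have hc' := (h.idem fun z => ColorEquiv U Δ (∑ i ∈ S, y i + z) t).1 hc
  filter_upwards [hc, hc'] with z hz hz'
  filter_upwards [hz'] with w hw
  rw [add_assoc]
  exact hz.trans hw.symm

theorem eventually_absorbsMiddle_of_absorbsRight (h : GenericSeq U Δ y)
    (h1 : ∀ᶠ z in U, AbsorbsRight U Δ z) : ∀ᶠ z in U, AbsorbsMiddle U Δ z := by
  filter_upwards [h1] with z hz
  filter_upwards [(h.idem fun w => Δ (z + w) = Δ z).1 hz] with w hw
  filter_upwards [hz, hw] with u hu hu'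
  rw [hu, add_assoc, hu']

/-- Without middle absorption, distinct index sets give inequivalent sums. -/
theorem not_equiv_of_ne (h : GenericSeq U Δ y) (h3 : ¬ ∀ᶠ z in U, AbsorbsMiddle U Δ z) (n : ℕ) :
    ∀ S ⊆ range n, ∀ T ⊆ range n, S ≠ T → ¬ ColorEquiv U Δ (∑ i ∈ S, y i) (∑ i ∈ T, y i) := by
  induction n with
  | zero =>
    intro S hS T hT hST
    rw [range_zero, subset_empty] at hS hT
    exact absurd (hS.trans hT.symm) hST
  | succ n ih =>
    intro S hS' T hT' hST
    obtain hS | ⟨S, hS, hnS, rfl⟩ := subset_range_of_insert hS' <;>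
    obtain hT | ⟨T, hT, hnT, rfl⟩ := subset_range_of_insert hT'
    · exact ih S hS T hT hST
    · rw [sum_insert_last hnT]
      exact fun he => h3 (h.eventually_absorbsMiddle_of_equiv_const
        ((h.equiv_const_iff hT hS).1 he.symm))
    · rw [sum_insert_last hnS]
      exact fun he => h3 (h.eventually_absorbsMiddle_of_equiv_const
        ((h.equiv_const_iff hS hT).1 he))
    · rw [sum_insert_last hnS, sum_insert_last hnT, h.equiv_add_iff hS hT]
      exact ih S hS T hT fun e => hST (e ▸ rfl)

/-- Without middle absorption, distinct nonempty index sets give distinct colors. -/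
theorem color_ne_of_ne (h : GenericSeq U Δ y) (h3 : ¬ ∀ᶠ z in U, AbsorbsMiddle U Δ z) (n : ℕ) :
    ∀ S ⊆ range n, ∀ T ⊆ range n, S.Nonempty → T.Nonempty → S ≠ T →
      Δ (∑ i ∈ S, y i) ≠ Δ (∑ i ∈ T, y i) := by
  have h1 : ¬ ∀ᶠ z in U, AbsorbsRight U Δ z := fun h1 =>
    h3 (h.eventually_absorbsMiddle_of_absorbsRight h1)
  induction n with
  | zero =>
    intro S hS T hT hne
    rw [range_zero, subset_empty] at hS
    simp [hS] at hne
  | succ n ih =>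
    intro S hS' T hT' hSne hTne hST
    obtain hS | ⟨S, hS, hnS, rfl⟩ := subset_range_of_insert hS' <;>
    obtain hT | ⟨T, hT, hnT, rfl⟩ := subset_range_of_insert hT'
    · exact ih S hS T hT hSne hTne hST
    · rw [sum_insert_last hnT]
      exact (h.color_ne_of_not_absorbsRight h1 hT hS).symm
    · rw [sum_insert_last hnS]
      exact h.color_ne_of_not_absorbsRight h1 hS hT
    · rw [sum_insert_last hnS, sum_insert_last hnT, Ne, h.color_eq_iff hS hT]
      exact h.not_equiv_of_ne h3 n S hS T hT fun e => hST (e ▸ rfl)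

/-- Inductive step of `not_equiv_of_min_ne` when only one index set contains `n`. -/
theorem not_equiv_insert_of_min_ne (h : GenericSeq U Δ y) (h2 : ¬ ∀ᶠ z in U, ColorEquiv U Δ z 0)
    {n : ℕ} {S T : Finset ℕ} (hS : S ⊆ range n) (hT : T ⊆ range n)
    (ih : S.min ≠ T.min → ¬ ColorEquiv U Δ (∑ i ∈ S, y i) (∑ i ∈ T, y i))
    (hST : (insert n S).min ≠ T.min) :
    ¬ ColorEquiv U Δ (∑ i ∈ S, y i + y n) (∑ i ∈ T, y i) := by
  intro he
  have hc := (h.equiv_const_iff hS hT).1 he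
  obtain rfl | hne := S.eq_empty_or_nonempty
  · -- Almost all `z` and `z + w` are equivalent to the same number, hence `z + w` to `w`.
    simp only [sum_empty, zero_add] at hc
    refine h2 ?_
    filter_upwards [(h.idem fun z => ColorEquiv U Δ z (∑ i ∈ T, y i)).1 hc] with z hz
    rw [h.idem.equiv_iff]
    filter_upwards [hz, hc] with w hw hw'
    rw [zero_add]
    exact hw.trans hw'.symm
  · have h3 := (h.absorbsMiddle_iff hne).2 (h.eventually_absorbsMiddle_of_equiv_const hc)
    obtain ⟨z, hz, hz'⟩ := (hc.and h3).exists
    rw [min_insert_last hS hne] at hST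
    exact ih hST (hz'.trans hz)

/-- If almost no number is equivalent to `0`, sums with distinct first terms are inequivalent. -/
theorem not_equiv_of_min_ne (h : GenericSeq U Δ y) (h2 : ¬ ∀ᶠ z in U, ColorEquiv U Δ z 0) (n : ℕ) :
    ∀ S ⊆ range n, ∀ T ⊆ range n, S.min ≠ T.min →
      ¬ ColorEquiv U Δ (∑ i ∈ S, y i) (∑ i ∈ T, y i) := by
  induction n with
  | zero =>
    intro S hS T hT hST
    rw [range_zero, subset_empty] at hS hT
    exact absurd (by rw [hS, hT]) hST
  | succ n ih =>
    intro S hS' T hT' hST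
    obtain hS | ⟨S, hS, hnS, rfl⟩ := subset_range_of_insert hS' <;>
    obtain hT | ⟨T, hT, hnT, rfl⟩ := subset_range_of_insert hT'
    · exact ih S hS T hT hST
    · rw [sum_insert_last hnT]
      exact fun he => h.not_equiv_insert_of_min_ne h2 hT hS (ih T hT S hS) hST.symm he.symm
    · rw [sum_insert_last hnS]
      exact h.not_equiv_insert_of_min_ne h2 hS hT (ih S hS T hT) hST
    · rw [sum_insert_last hnS, sum_insert_last hnT, h.equiv_add_iff hS hT]
      exact ih S hS T hT fun e => hST (by rw [min_insert, min_insert, e])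

theorem color_ne_of_max_ne (h : GenericSeq U Δ y) (h1 : ¬ ∀ᶠ z in U, AbsorbsRight U Δ z)
    {S T : Finset ℕ} (hS : S.Nonempty) (hT : T.Nonempty) (hST : S.max ≠ T.max) :
    Δ (∑ i ∈ S, y i) ≠ Δ (∑ i ∈ T, y i) := by
  obtain ⟨a, ha⟩ := max_of_nonempty hS
  obtain ⟨b, hb⟩ := max_of_nonempty hT
  rw [ha, hb] at hST
  obtain ⟨S, hSa, haS, rfl⟩ := subset_range_of_mem_max ha
  obtain ⟨T, hTb, hbT, rfl⟩ := subset_range_of_mem_max hb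
  obtain hab | rfl | hab := lt_trichotomy a b
  · rw [sum_insert_last hbT]
    refine (h.color_ne_of_not_absorbsRight h1 hTb ?_).symm
    exact insert_subset (mem_range.2 hab) (hSa.trans (range_mono hab.le))
  · exact absurd rfl hST
  · rw [sum_insert_last haS]
    refine h.color_ne_of_not_absorbsRight h1 hSa ?_
    exact insert_subset (mem_range.2 hab) (hTb.trans (range_mono hab.le))

/-- If almost no number is equivalent to `0`, sums with distinct first terms differ in color. -/
theorem color_ne_of_min_ne (h : GenericSeq U Δ y) (h2 : ¬ ∀ᶠ z in U, ColorEquiv U Δ z 0)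
    {S T : Finset ℕ} (hS : S.Nonempty) (hT : T.Nonempty) (hST : S.min ≠ T.min) :
    Δ (∑ i ∈ S, y i) ≠ Δ (∑ i ∈ T, y i) := by
  by_cases h1 : ∀ᶠ z in U, AbsorbsRight U Δ z
  · -- Neither color changes if a common later term is added.
    obtain ⟨n, hSn, hTn⟩ := exists_subset_range₂ S T
    rw [← (h.color_eq_const_iff hSn hSn).2 ((h.absorbsRight_iff hS).2 h1),
      ← (h.color_eq_const_iff hTn hTn).2 ((h.absorbsRight_iff hT).2 h1), Ne,
      h.color_eq_iff hSn hTn]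
    exact h.not_equiv_of_min_ne h2 n S hSn T hTn hST
  · by_cases hmax : S.max = T.max
    · obtain ⟨b, hb⟩ := max_of_nonempty hS
      obtain ⟨T, hTb, hbT, rfl⟩ := subset_range_of_mem_max (hmax ▸ hb)
      obtain ⟨S, hSb, hbS, rfl⟩ := subset_range_of_mem_max hb
      rw [sum_insert_last hbS, sum_insert_last hbT, Ne, h.color_eq_iff hSb hTb]
      refine h.not_equiv_of_min_ne h2 b S hSb T hTb fun e => hST ?_
      rw [min_insert, min_insert, e]
    · exact h.color_ne_of_max_ne h1 hS hT hmax

/-- Under middle absorption the first and last terms of a sum determine its color. -/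
theorem color_eq_of_min_eq_of_max_eq (h : GenericSeq U Δ y)
    (h3 : ∀ᶠ z in U, AbsorbsMiddle U Δ z) {S T : Finset ℕ} (hS : S.Nonempty)
    (hmin : S.min = T.min) (hmax : S.max = T.max) :
    Δ (∑ i ∈ S, y i) = Δ (∑ i ∈ T, y i) := by
  obtain ⟨b, hb⟩ := max_of_nonempty hS
  obtain ⟨S, hSb, hbS, rfl⟩ := subset_range_of_mem_max hb
  obtain ⟨T, hTb, hbT, rfl⟩ := subset_range_of_mem_max (hmax ▸ hb)
  rw [sum_insert_last hbS, sum_insert_last hbT, h.color_eq_iff hSb hTb]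
  have key : ∀ S ⊆ range b, ∀ T : Finset ℕ, (insert b S).min = (insert b T).min →
      T = ∅ → S = ∅ := by
    rintro S hSb T hmin rfl
    by_contra hne
    obtain ⟨a, ha⟩ := min_of_nonempty (nonempty_iff_ne_empty.2 hne)
    rw [min_insert_last hSb (nonempty_iff_ne_empty.2 hne), ha] at hmin
    have := mem_range.1 (hSb (mem_of_min ha))
    simp at hmin
    omega
  obtain rfl | hSne := S.eq_empty_or_nonempty
  · rw [key T hTb ∅ hmin.symm rfl]
    exact ColorEquiv.refl _
  · have hTne : T.Nonempty := by
      rw [nonempty_iff_ne_empty] at hSne ⊢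
      exact fun hT => hSne (key S hSb T hmin hT)
    rw [min_insert_last hSb hSne, min_insert_last hTb hTne] at hmin
    obtain ⟨a, ha⟩ := min_of_nonempty hSne
    exact (h.equiv_of_absorbsMiddle h3 ha).trans (h.equiv_of_absorbsMiddle h3 (hmin ▸ ha)).symm

end GenericSeq

/-- **Taylor's canonical version of Hindman's theorem**: for every coloring there is a sequence,
growing so fast that distinct index sets have distinct sums, for which the color of a finite
sum is constant, or encodes exactly the first index, the last index, the pair of both, or the
whole index set. -/
theorem exists_canonical (Δ : ℕ → ℕ) :
    ∃ y : ℕ → ℕ, (∀ n, ∀ S ⊆ range n, ∑ i ∈ S, y i < y n) ∧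
      ((∀ S T : Finset ℕ, S.Nonempty → T.Nonempty → Δ (∑ i ∈ S, y i) = Δ (∑ i ∈ T, y i)) ∨
      (∀ S T : Finset ℕ, S.Nonempty → T.Nonempty →
        (Δ (∑ i ∈ S, y i) = Δ (∑ i ∈ T, y i) ↔ S = T)) ∨
      (∀ S T : Finset ℕ, S.Nonempty → T.Nonempty →
        (Δ (∑ i ∈ S, y i) = Δ (∑ i ∈ T, y i) ↔ S.max = T.max)) ∨
      (∀ S T : Finset ℕ, S.Nonempty → T.Nonempty →
        (Δ (∑ i ∈ S, y i) = Δ (∑ i ∈ T, y i) ↔ S.min = T.min)) ∨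
      (∀ S T : Finset ℕ, S.Nonempty → T.Nonempty →
        (Δ (∑ i ∈ S, y i) = Δ (∑ i ∈ T, y i) ↔ S.min = T.min ∧ S.max = T.max))) := by
  obtain ⟨U, hU, hlt⟩ := exists_isIdempotent
  obtain ⟨y, hy, hgen⟩ := exists_generic hlt (predicates U Δ)
  have h : GenericSeq U Δ y := ⟨hU, hgen⟩
  refine ⟨y, hy, ?_⟩
  by_cases h3 : ∀ᶠ z in U, AbsorbsMiddle U Δ z
  swap
  · refine Or.inr (Or.inl fun S T hS hT => ⟨fun e => ?_, fun e => e ▸ rfl⟩)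
    obtain ⟨n, hSn, hTn⟩ := exists_subset_range₂ S T
    by_contra hST
    exact h.color_ne_of_ne h3 n S hSn T hTn hS hT hST e
  by_cases h1 : ∀ᶠ z in U, AbsorbsRight U Δ z <;> by_cases h2 : ∀ᶠ z in U, ColorEquiv U Δ z 0
  · refine Or.inl fun S T hS hT => ?_
    obtain ⟨n, hSn, hTn⟩ := exists_subset_range₂ S T
    rw [← (h.color_eq_const_iff hSn hSn).2 ((h.absorbsRight_iff hS).2 h1),
      ← (h.color_eq_const_iff hTn hTn).2 ((h.absorbsRight_iff hT).2 h1),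
      h.color_eq_iff hSn hTn]
    exact ((h.equiv_zero_iff hS).2 h2).trans ((h.equiv_zero_iff hT).2 h2).symm
  · refine Or.inr (Or.inr (Or.inr (Or.inl fun S T hS hT => ⟨fun e => ?_, fun e => ?_⟩)))
    · by_contra hST
      exact h.color_ne_of_min_ne h2 hS hT hST e
    · obtain ⟨a, ha⟩ := min_of_nonempty hS
      rw [h.color_eq_of_absorbsRight h1 ha, h.color_eq_of_absorbsRight h1 (e ▸ ha)]
  · refine Or.inr (Or.inr (Or.inl fun S T hS hT => ⟨fun e => ?_, fun e => ?_⟩))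
    · by_contra hST
      exact h.color_ne_of_max_ne h1 hS hT hST e
    · obtain ⟨b, hb⟩ := max_of_nonempty hS
      rw [h.color_eq_of_equiv_zero h2 hb, h.color_eq_of_equiv_zero h2 (e ▸ hb)]
  · refine Or.inr (Or.inr (Or.inr (Or.inr fun S T hS hT => ⟨fun e => ⟨?_, ?_⟩, fun e => ?_⟩)))
    · by_contra hST
      exact h.color_ne_of_min_ne h2 hS hT hST e
    · by_contra hST
      exact h.color_ne_of_max_ne h1 hS hT hST e
    · exact h.color_eq_of_min_eq_of_max_eq h3 hS e.1 e.2

end Canonical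

/-! ### Alternating sums as sums over index sets -/

/-- If each `x i` is the sum of `y 0, …, y i`, then the alternating sum of `x` over `J` is the
sum of `y` over `signSupport J`: the indices `n` with an odd number of elements of `J` from `n`
on. The cutoff `J.sup id + 1` only serves to make the set finite, see `mem_signSupport`. -/
def signSupport (J : Finset ℕ) : Finset ℕ :=
  (range (J.sup id + 1)).filter fun n => Odd (J.filter (n ≤ ·)).card

theorem mem_signSupport {J : Finset ℕ} {n : ℕ} :
    n ∈ signSupport J ↔ Odd (J.filter (n ≤ ·)).card := by
  rw [signSupport, mem_filter, mem_range, and_iff_right_iff_imp]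
  intro h
  obtain ⟨j, hj⟩ := card_pos.1 h.pos
  rw [mem_filter] at hj
  exact Nat.lt_succ_of_le (hj.2.trans (le_sup (f := id) hj.1))

theorem signSupport_insert {J : Finset ℕ} {m : ℕ} (h : ∀ j ∈ J, j < m) :
    signSupport (insert m J) = range (m + 1) \ signSupport J := by
  ext n
  rw [Finset.mem_sdiff, mem_signSupport, mem_signSupport, mem_range, Nat.lt_succ_iff, filter_insert]
  split_ifs with hn
  · rw [card_insert_of_notMem (fun hm => lt_irrefl m (h m (mem_filter.1 hm).1)), Nat.odd_add_one]
    simp [hn]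
  · have : J.filter (n ≤ ·) = ∅ := filter_eq_empty_iff.2 fun j hj hnj => hn (hnj.trans (h j hj).le)
    simp [this, hn]

theorem signSupport_subset_range {J : Finset ℕ} {m : ℕ} (h : ∀ j ∈ J, j < m) :
    signSupport J ⊆ range (m + 1) := by
  intro n hn
  obtain ⟨j, hj⟩ := card_pos.1 (mem_signSupport.1 hn).pos
  rw [mem_filter] at hj
  have := h j hj.1
  rw [mem_range]
  omega

theorem altSum_eq_sum_signSupport (y : ℕ → ℕ) (J : Finset ℕ) :
    altSum (fun i => ∑ n ∈ range (i + 1), y n) J = ∑ n ∈ signSupport J, y n := by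
  have key : altSumInt (fun i => ∑ n ∈ range (i + 1), y n) J =
      ((∑ n ∈ signSupport J, y n : ℕ) : ℤ) := by
    induction J using Finset.induction_on_max with
    | empty => simp [altSumInt, signSupport]
    | insert m J h ih =>
      rw [altSumInt_insert _ m J h, signSupport_insert h, ih, sub_eq_iff_eq_add]
      exact_mod_cast (sum_sdiff (signSupport_subset_range h)).symm
  rw [altSum, key, Int.toNat_natCast]

theorem mem_iff_signSupport {J : Finset ℕ} {n : ℕ} :
    n ∈ J ↔ ¬(n ∈ signSupport J ↔ n + 1 ∈ signSupport J) := by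
  rw [mem_signSupport, mem_signSupport]
  by_cases hn : n ∈ J
  · have : J.filter (n ≤ ·) = insert n (J.filter (n + 1 ≤ ·)) := by
      ext j
      simp only [mem_filter, mem_insert]
      grind
    rw [this, card_insert_of_notMem (by simp), Nat.odd_add_one]
    simp only [hn, true_iff]
    tauto
  · have : J.filter (n ≤ ·) = J.filter (n + 1 ≤ ·) := by
      refine filter_congr fun j hj => ?_
      have : j ≠ n := fun e => hn (e ▸ hj)
      omega
    simp [this, hn]

theorem signSupport_injective : Function.Injective signSupport := by
  intro I J h
  ext n
  rw [mem_iff_signSupport (J := I), mem_iff_signSupport (J := J), h]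

/-- The support of an alternating sum with evenly many terms starts right above `min J`. -/
theorem min_signSupport {J : Finset ℕ} (hJ : Even J.card) {a : ℕ}
    (ha : J.min = (a : WithTop ℕ)) : (signSupport J).min = ((a + 1 : ℕ) : WithTop ℕ) := by
  have haJ : a ∈ J := mem_of_min ha
  refine le_antisymm (min_le (show a + 1 ∈ signSupport J from mem_signSupport.2 ?_))
    (Finset.le_min fun b hb => WithTop.coe_le_coe.2 ?_)
  · have : J.filter (a + 1 ≤ ·) = J.erase a := by
      ext j
      simp only [mem_filter, mem_erase]
      constructor
      · exact fun h => ⟨by omega, h.1⟩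
      · exact fun h => ⟨h.2, Nat.lt_of_le_of_ne (min_le_of_eq h.2 ha) h.1.symm⟩
    rw [this, card_erase_of_mem haJ]
    exact Nat.Even.sub_odd (card_pos.2 ⟨a, haJ⟩) hJ odd_one
  · by_contra hab
    rw [mem_signSupport, filter_true_of_mem fun j hj =>
      (Nat.lt_succ_iff.1 (not_le.1 hab)).trans (min_le_of_eq hj ha)] at hb
    exact Nat.not_odd_iff_even.2 hJ hb

theorem max_signSupport {J : Finset ℕ} {b : ℕ} (hb : J.max = (b : WithBot ℕ)) :
    (signSupport J).max = (b : WithBot ℕ) := by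
  have hbJ : b ∈ J := mem_of_max hb
  refine le_antisymm (Finset.max_le fun c hc => WithBot.coe_le_coe.2 ?_)
    (le_max (show b ∈ signSupport J from mem_signSupport.2 ?_))
  · obtain ⟨j, hj⟩ := card_pos.1 (mem_signSupport.1 hc).pos
    rw [mem_filter] at hj
    exact hj.2.trans (le_max_of_eq hj.1 hb)
  · have : J.filter (b ≤ ·) = {b} := by
      ext j
      simp only [mem_filter, mem_singleton]
      exact ⟨fun h => le_antisymm (le_max_of_eq h.1 hb) h.2, fun h => ⟨h ▸ hbJ, h.ge⟩⟩
    simp [this]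

theorem signSupport_nonempty {J : Finset ℕ} (hJ : J.Nonempty) : (signSupport J).Nonempty := by
  obtain ⟨b, hb⟩ := max_of_nonempty hJ
  exact ⟨b, mem_of_max (max_signSupport hb)⟩

theorem zero_notMem_signSupport {J : Finset ℕ} (hJ : Even J.card) : 0 ∉ signSupport J := by
  rw [mem_signSupport, filter_true_of_mem fun j _ => Nat.zero_le j]
  exact Nat.not_odd_iff_even.2 hJ

theorem min_signSupport_eq_iff {I J : Finset ℕ} (hI : Even I.card) (hJ : Even J.card)
    (hIne : I.Nonempty) (hJne : J.Nonempty) :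
    (signSupport I).min = (signSupport J).min ↔ I.min = J.min := by
  obtain ⟨a, ha⟩ := min_of_nonempty hIne
  obtain ⟨b, hb⟩ := min_of_nonempty hJne
  rw [min_signSupport hI ha, min_signSupport hJ hb, ha, hb]
  exact (WithTop.coe_inj.trans Nat.succ_inj).trans WithTop.coe_inj.symm

theorem max_signSupport_eq {J : Finset ℕ} (hJ : J.Nonempty) : (signSupport J).max = J.max := by
  obtain ⟨b, hb⟩ := max_of_nonempty hJ
  exact (max_signSupport hb).trans hb.symm

theorem min_range_succ (i : ℕ) : (range (i + 1)).min = ((0 : ℕ) : WithTop ℕ) :=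
  le_antisymm (min_le (by simp)) (Finset.le_min fun _ _ => WithTop.coe_le_coe.2 (Nat.zero_le _))

theorem max_range_succ (i : ℕ) : (range (i + 1)).max = (i : WithBot ℕ) :=
  le_antisymm (Finset.max_le fun _ h => WithBot.coe_le_coe.2 (Nat.lt_succ_iff.1 (mem_range.1 h)))
    (le_max (by simp))

theorem sum_injective_of_lt {y : ℕ → ℕ} (hy : ∀ n, ∀ S ⊆ range n, ∑ i ∈ S, y i < y n) :
    Function.Injective fun S : Finset ℕ => ∑ i ∈ S, y i := by
  have key : ∀ n, ∀ S ⊆ range n, ∀ T ⊆ range n, ∑ i ∈ S, y i = ∑ i ∈ T, y i → S = T := by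
    intro n
    induction n with
    | zero =>
      intro S hS T hT _
      rw [range_zero, subset_empty] at hS hT
      rw [hS, hT]
    | succ n ih =>
      intro S hS' T hT' hST
      obtain hS | ⟨S, hS, hnS, rfl⟩ := subset_range_of_insert hS' <;>
      obtain hT | ⟨T, hT, hnT, rfl⟩ := subset_range_of_insert hT'
      · exact ih S hS T hT hST
      · rw [sum_insert_last hnT] at hST
        have := hy n S hS
        omega
      · rw [sum_insert_last hnS] at hST
        have := hy n T hT
        omega
      · rw [sum_insert_last hnS, sum_insert_last hnT] at hST
        rw [ih S hS T hT (by omega)]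
  intro S T hST
  obtain ⟨n, hS, hT⟩ := exists_subset_range₂ S T
  exact key n S hS T hT hST

/-- The partial sums of the sequence of `exists_canonical` follow one of the five patterns: they
correspond to index sets with first index `0`, the alternating sums to index sets with larger
first index. -/
theorem exists_follows {k : ℕ} (hk : 2 ≤ k) (hk_even : Even k) (Δ : ℕ → ℕ) :
    ∃ x : ℕ → ℕ, IsSeq x ∧ PairwiseDistinct k x ∧ ∃ p : Pattern, Follows k Δ x p := by
  obtain ⟨y, hy, hcases⟩ := exists_canonical Δ
  have hpos : ∀ n, 0 < y n := fun n => (Nat.zero_le _).trans_lt (hy n ∅ (empty_subset _))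
  have hne : ∀ {J : Finset ℕ}, J.card = k → J.Nonempty := fun h => card_pos.1 (by omega)
  have hrange : ∀ i, (range (i + 1)).Nonempty := fun i => ⟨0, by simp⟩
  have hev : ∀ {J : Finset ℕ}, J.card = k → Even J.card := fun h => h.symm ▸ hk_even
  have hsup : ∀ {J : Finset ℕ}, J.card = k → (signSupport J).Nonempty := fun h =>
    signSupport_nonempty (hne h)
  have hdisj : ∀ {J : Finset ℕ} {i : ℕ}, J.card = k →
      (range (i + 1)).min ≠ (signSupport J).min := by
    intro J i hJ e
    rw [min_range_succ] at e
    exact zero_notMem_signSupport (hev hJ) (mem_of_min e.symm)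
  have hrangeinj : ∀ {i j : ℕ}, (range (i + 1)).max = (range (j + 1)).max → i = j := by
    intro i j h
    rw [max_range_succ, max_range_succ] at h
    exact WithBot.coe_inj.1 h
  refine ⟨fun i => ∑ n ∈ range (i + 1), y n, ⟨strictMono_nat_of_lt_succ fun i => ?_, fun i => ?_⟩,
    ?_, ?_⟩
  · rw [sum_range_succ _ (i + 1)]
    exact Nat.lt_add_of_pos_right (hpos _)
  · exact sum_pos (fun n _ => hpos n) (hrange i)
  · rintro (i | I) (j | J) h <;>
      simp only [Sum.elim_inl, Sum.elim_inr, altSum_eq_sum_signSupport] at h <;>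
      have h := sum_injective_of_lt hy h
    · rw [hrangeinj (congrArg Finset.max h)]
    · exact absurd (congrArg Finset.min h) (hdisj J.2)
    · exact absurd (congrArg Finset.min h).symm (hdisj I.2)
    · rw [Subtype.ext (signSupport_injective h)]
  · obtain h | h | h | h | h := hcases
    · refine ⟨.mono, ?_⟩
      rintro _ (⟨i, rfl⟩ | ⟨I, hI, rfl⟩) _ (⟨j, rfl⟩ | ⟨J, hJ, rfl⟩) <;>
        simp only [altSum_eq_sum_signSupport] <;>
        exact h _ _ (by first | exact hrange _ | exact hsup ‹_›)
          (by first | exact hrange _ | exact hsup ‹_›)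
    · refine ⟨.rainbow, ?_⟩
      rintro _ (⟨i, rfl⟩ | ⟨I, hI, rfl⟩) _ (⟨j, rfl⟩ | ⟨J, hJ, rfl⟩) hc <;>
        simp only [altSum_eq_sum_signSupport] at hc ⊢ <;>
        rw [(h _ _ (by first | exact hrange _ | exact hsup ‹_›)
          (by first | exact hrange _ | exact hsup ‹_›)).1 hc]
    · refine ⟨.byMax, ?_, fun J hJ m hm => ?_⟩
      · rintro _ ⟨i, rfl⟩ _ ⟨j, rfl⟩ hc
        rw [hrangeinj ((h _ _ (hrange i) (hrange j)).1 hc)]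
      · rw [altSum_eq_sum_signSupport, h _ _ (hsup hJ) (hrange m), max_signSupport hm,
          max_range_succ]
    · refine ⟨.byMin, ?_, ?_, fun I J hI hJ => ?_⟩
      · rintro _ ⟨i, rfl⟩ _ ⟨j, rfl⟩
        rw [h _ _ (hrange i) (hrange j), min_range_succ, min_range_succ]
      · rw [← Set.disjoint_iff_inter_eq_empty, Set.disjoint_left]
        rintro _ ⟨_, ⟨i, rfl⟩, rfl⟩ ⟨_, ⟨J, hJ, rfl⟩, hc⟩
        rw [altSum_eq_sum_signSupport] at hc
        exact hdisj hJ ((h _ _ (hsup hJ) (hrange i)).1 hc).symm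
      · rw [altSum_eq_sum_signSupport, altSum_eq_sum_signSupport, eq_comm,
          h _ _ (hsup hI) (hsup hJ),
          min_signSupport_eq_iff (hev hI) (hev hJ) (hne hI) (hne hJ)]
    · refine ⟨.byMinMax, ?_, ?_, fun I J hI hJ => ?_⟩
      · rintro _ ⟨i, rfl⟩ _ ⟨j, rfl⟩ hc
        rw [hrangeinj ((h _ _ (hrange i) (hrange j)).1 hc).2]
      · rw [← Set.disjoint_iff_inter_eq_empty, Set.disjoint_left]
        rintro _ ⟨_, ⟨i, rfl⟩, rfl⟩ ⟨_, ⟨J, hJ, rfl⟩, hc⟩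
        rw [altSum_eq_sum_signSupport] at hc
        exact hdisj hJ ((h _ _ (hsup hJ) (hrange i)).1 hc).1.symm
      · rw [altSum_eq_sum_signSupport, altSum_eq_sum_signSupport, eq_comm,
          h _ _ (hsup hI) (hsup hJ),
          min_signSupport_eq_iff (hev hI) (hev hJ) (hne hI) (hne hJ),
          max_signSupport_eq (hne hI), max_signSupport_eq (hne hJ)]

section Colorings

variable {k : ℕ} {x : ℕ → ℕ}

/-! ### Colorings that admit only one pattern -/

theorem not_rainbow_of_eq {Δ : ℕ → ℕ} (hx : IsSeq x) {i j : ℕ} (hij : i ≠ j)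
    (h : Δ (x i) = Δ (x j)) : ¬ Rainbow Δ (Set.range x) := fun hr =>
  hij (hx.1.injective (hr ⟨i, rfl⟩ ⟨j, rfl⟩ h))

theorem not_follows_const (hx : IsSeq x) {p : Pattern} (hp : p ≠ .mono) :
    ¬ Follows k (fun _ => 0) x p := by
  have hr := not_rainbow_of_eq (Δ := fun _ => 0) hx zero_ne_one rfl
  cases p with
  | mono => exact absurd rfl hp
  | rainbow => exact fun h => hr (h.mono Set.subset_union_left)
  | byMax => exact fun h => hr h.1
  | byMin =>
    intro h
    have h0 : (0 : ℕ) ∈ (∅ : Set ℕ) :=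
      h.2.1 ▸ ⟨⟨x 0, ⟨0, rfl⟩, rfl⟩, ⟨_, ⟨range k, card_range k, rfl⟩, rfl⟩⟩
    exact h0
  | byMinMax => exact fun h => hr h.1

theorem altSum_insert (hx : IsSeq x) {m : ℕ} {J : Finset ℕ} (h : ∀ j ∈ J, j < m) :
    (altSum x (insert m J) : ℤ) = x m - altSumInt x J := by
  rw [(altSum_cast hx (insert_nonempty m J)).1, altSumInt_insert x m J h]

theorem altSum_insert_lt (hx : IsSeq x) {m : ℕ} {J : Finset ℕ} (hJ : J.Nonempty)
    (h : ∀ j ∈ J, j < m) : altSum x (insert m J) < x m := by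
  have h1 := altSum_insert hx h
  have h2 := (altSumInt_bounds hx J).1 hJ
  omega

theorem lt_of_mem_insert {a m : ℕ} {K : Finset ℕ} (hK : ∀ j ∈ K, j < a) (h : a < m) :
    ∀ j ∈ insert a K, j < m := by
  intro j hj
  obtain rfl | hj := mem_insert.1 hj
  · exact h
  · exact (hK j hj).trans h

/-- Changing the second largest index changes the alternating sum. -/
theorem altSum_insert_insert_ne (hx : IsSeq x) {m a b : ℕ} {K : Finset ℕ} (hab : a ≠ b)
    (ha : ∀ j ∈ K, j < a) (hb : ∀ j ∈ K, j < b) (ham : a < m) (hbm : b < m) :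
    altSum x (insert m (insert a K)) ≠ altSum x (insert m (insert b K)) := by
  intro h
  have h1 := altSum_insert hx (lt_of_mem_insert ha ham)
  have h2 := altSum_insert hx (lt_of_mem_insert hb hbm)
  rw [altSumInt_insert x _ K ha] at h1
  rw [altSumInt_insert x _ K hb] at h2
  exact hab (hx.1.injective (by omega))

theorem card_insert_of_lt {m : ℕ} {K : Finset ℕ} (h : ∀ j ∈ K, j < m) :
    (insert m K).card = K.card + 1 :=
  card_insert_of_notMem fun hm => lt_irrefl m (h m hm)

theorem max_insert_of_lt {m : ℕ} {K : Finset ℕ} (h : ∀ j ∈ K, j < m) :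
    (insert m K).max = (m : WithBot ℕ) :=
  max_insert_last fun j hj => mem_range.2 (h j hj)

theorem min_insert_of_lt {m : ℕ} {K : Finset ℕ} (h : ∀ j ∈ K, j < m) (hK : K.Nonempty) :
    (insert m K).min = K.min :=
  min_insert_last (fun j hj => mem_range.2 (h j hj)) hK

theorem range_lt {n m : ℕ} (h : n ≤ m) : ∀ j ∈ range n, j < m := fun _ hj =>
  (mem_range.1 hj).trans_le h

theorem not_follows_id (hk : 2 ≤ k) (hx : IsSeq x) {p : Pattern} (hp : p ≠ .rainbow)
    (hp' : p = .byMinMax → 4 ≤ k) : ¬ Follows k id x p := by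
  have hm : ¬ Monochromatic id (Set.range x) := fun h =>
    (hx.1 zero_lt_one).ne (h _ ⟨0, rfl⟩ _ ⟨1, rfl⟩)
  cases p with
  | mono => exact fun h => hm fun a ha b hb => h a (Or.inl ha) b (Or.inl hb)
  | rainbow => exact absurd rfl hp
  | byMax =>
    intro h
    have hlt := range_lt (le_refl (k - 1))
    refine (altSum_insert_lt hx ⟨0, mem_range.2 (by omega)⟩ hlt).ne (h.2 _ ?_ (k - 1) ?_)
    · rw [card_insert_of_lt hlt, card_range]
      omega
    · exact max_insert_of_lt hlt
  | byMin => exact fun h => hm h.1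
  | byMinMax =>
    intro h
    have hk4 := hp' rfl
    have h1 := range_lt (le_refl (k - 2))
    have h2 := range_lt (show k - 2 ≤ k - 1 by omega)
    have h3 := lt_of_mem_insert h1 (show k - 2 < k by omega)
    have h4 := lt_of_mem_insert h2 (show k - 1 < k by omega)
    have hne : (range (k - 2)).Nonempty := ⟨0, mem_range.2 (by omega)⟩
    refine altSum_insert_insert_ne hx (show k - 2 ≠ k - 1 by omega) h1 h2 (m := k) (by omega)
      (by omega) ((h.2.2 _ _ ?_ ?_).2 ?_)
    · rw [card_insert_of_lt h4, card_insert_of_lt h2, card_range]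
      omega
    · rw [card_insert_of_lt h3, card_insert_of_lt h1, card_range]
      omega
    · rw [min_insert_of_lt h3 (insert_nonempty _ _), min_insert_of_lt h4 (insert_nonempty _ _),
        min_insert_of_lt h1 hne, min_insert_of_lt h2 hne, max_insert_of_lt h3, max_insert_of_lt h4]
      exact ⟨rfl, rfl⟩

theorem not_monochromatic_log (hx : IsSeq x) : ¬ Monochromatic (Nat.log 2) (Set.range x) := by
  intro h
  have h1 : x 0 * 2 ≤ x (x 0 * 2) := hx.1.le_apply
  have h2 := Nat.log_mono_right (b := 2) h1
  rw [Nat.log_mul_base one_lt_two (hx.2 0).ne', h _ ⟨x 0 * 2, rfl⟩ _ ⟨0, rfl⟩] at h2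
  omega

/-- Subtracting at most half of `x m` lowers the binary logarithm by at most one. -/
theorem log_altSum_insert (hx : IsSeq x) {m M : ℕ} {J : Finset ℕ} (hJ : ∀ j ∈ J, j < M)
    (hm : 2 * x M ≤ m) : Nat.log 2 (altSum x (insert m J)) ≤ Nat.log 2 (x m) ∧
      Nat.log 2 (x m) ≤ Nat.log 2 (altSum x (insert m J)) + 1 := by
  have hM : M ≤ x M := hx.1.le_apply
  have hm' : m ≤ x m := hx.1.le_apply
  have h1 := altSum_insert hx (J := J) (m := m) fun j hj => (hJ j hj).trans_le (by omega)
  obtain ⟨-, h2, h3⟩ := altSumInt_bounds hx J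
  have h3 := h3 M hJ
  refine ⟨Nat.log_mono_right (by omega), ?_⟩
  rw [← Nat.log_mul_base one_lt_two (altSum_cast hx (insert_nonempty m J)).2.ne']
  exact Nat.log_mono_right (by omega)

theorem not_follows_log (hk : 2 ≤ k) (hx : IsSeq x) {p : Pattern} (hp : p ≠ .byMax) :
    ¬ Follows k (Nat.log 2) x p := by
  have hm := not_monochromatic_log hx
  cases p with
  | mono => exact fun h => hm fun a ha b hb => h a (Or.inl ha) b (Or.inl hb)
  | rainbow =>
    intro h
    -- Two of the three numbers `x m` and the two sums with top index `m` share their logarithm.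
    have h1 := range_lt (le_refl (k - 2))
    have h2 := range_lt (show k - 2 ≤ k - 1 by omega)
    have h3 := lt_of_mem_insert h1 (show k - 2 < k by omega)
    have h4 := lt_of_mem_insert h2 (show k - 1 < k by omega)
    obtain ⟨m, hm⟩ : ∃ m, m = 2 * x k := ⟨_, rfl⟩
    have hkm : k < m := by
      have : k ≤ x k := hx.1.le_apply
      omega
    have h3' := fun j hj => (h3 j hj).trans hkm
    have h4' := fun j hj => (h4 j hj).trans hkm
    have l3 := log_altSum_insert hx h3 hm.ge
    have l4 := log_altSum_insert hx h4 hm.ge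
    have m3 : altSum x (insert m (insert (k - 2) (range (k - 2)))) ∈ altSums k x := by
      refine ⟨_, ?_, rfl⟩
      rw [card_insert_of_lt h3', card_insert_of_lt h1, card_range]
      omega
    have m4 : altSum x (insert m (insert (k - 1) (range (k - 2)))) ∈ altSums k x := by
      refine ⟨_, ?_, rfl⟩
      rw [card_insert_of_lt h4', card_insert_of_lt h2, card_range]
      omega
    have e1 := h.ne (Or.inr m3) (Or.inl ⟨m, rfl⟩) (altSum_insert_lt hx (insert_nonempty _ _) h3').ne
    have e2 := h.ne (Or.inr m4) (Or.inl ⟨m, rfl⟩) (altSum_insert_lt hx (insert_nonempty _ _) h4').ne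
    have e3 := h.ne (Or.inr m3) (Or.inr m4)
      (altSum_insert_insert_ne hx (by omega) h1 h2 (by omega) (by omega))
    omega
  | byMax => exact absurd rfl hp
  | byMin => exact fun h => hm h.1
  | byMinMax =>
    rintro ⟨-, -, h⟩
    -- Two of the three sums with first indices `0`, `1`, `2` and last index `m` share their color.
    obtain ⟨m, hm⟩ : ∃ m, m = 2 * x (k + 1) := ⟨_, rfl⟩
    have hkm : k + 1 < m := by
      have : k + 1 ≤ x (k + 1) := hx.1.le_apply
      omega
    have hlt : ∀ i ≤ 2, ∀ j ∈ Ico i (i + (k - 1)), j < k + 1 := fun i hi j hj => by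
      rw [mem_Ico] at hj
      omega
    have hlog := fun i hi => log_altSum_insert hx (hlt i hi) hm.ge
    have hcard : ∀ i ≤ 2, (insert m (Ico i (i + (k - 1)))).card = k := fun i hi => by
      rw [card_insert_of_lt fun j hj => (hlt i hi j hj).trans hkm, Nat.card_Ico]
      omega
    have hne : ∀ i i', i < i' → i' ≤ 2 →
        Nat.log 2 (altSum x (insert m (Ico i (i + (k - 1))))) ≠
          Nat.log 2 (altSum x (insert m (Ico i' (i' + (k - 1))))) := by
      intro i i' hii hi' e
      have hmin := ((h _ _ (hcard i' hi') (hcard i (by omega))).1 e).1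
      have hi : i ∈ insert m (Ico i (i + (k - 1))) :=
        mem_insert_of_mem (mem_Ico.2 ⟨le_rfl, by omega⟩)
      obtain ⟨a, ha⟩ := min_of_mem hi
      have hai := min_le_of_eq hi ha
      have := mem_of_min (hmin.trans ha)
      rw [mem_insert, mem_Ico] at this
      omega
    have l0 := hlog 0 (by omega)
    have l1 := hlog 1 (by omega)
    have l2 := hlog 2 (by omega)
    have e1 := hne 0 1 (by omega) (by omega)
    have e2 := hne 0 2 (by omega) (by omega)
    have e3 := hne 1 2 (by omega) (by omega)
    omega

theorem padicValNat_two_eq {n : ℕ} (hn : 0 < n) {a : ℤ} {b : ℕ} (hb : 0 < b)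
    (h : (2 : ℤ) ^ (padicValNat 2 b + 1) ∣ n - a) (ha : a = b ∨ a = -b) :
    padicValNat 2 n = padicValNat 2 b := by
  have h1 : ∀ d : ℤ, d ∣ a ↔ d ∣ (b : ℤ) := by
    rintro d
    obtain rfl | rfl := ha
    · rfl
    · exact dvd_neg
  have h2 : (2 : ℤ) ^ padicValNat 2 b ∣ a := (h1 _).2 (by exact_mod_cast pow_padicValNat_dvd)
  have h3 : ¬ (2 : ℤ) ^ (padicValNat 2 b + 1) ∣ a := by
    rw [h1]
    exact_mod_cast pow_succ_padicValNat_not_dvd hb.ne'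
  have h4 : 2 ^ padicValNat 2 b ∣ n := by
    have := (dvd_sub_left h2).1 ((pow_dvd_pow 2 (Nat.le_succ _)).trans h)
    exact_mod_cast this
  have h5 : ¬ 2 ^ (padicValNat 2 b + 1) ∣ n := by
    intro h5
    refine h3 ((dvd_sub_right ?_).1 h)
    exact_mod_cast h5
  rw [padicValNat_dvd_iff_le hn.ne'] at h4 h5
  omega

/-- Modulo `M`, an alternating sum of numbers congruent to `r` is `r` or `0`, according to the
parity of the number of terms. -/
theorem dvd_altSumInt_sub {M r : ℤ} {J : Finset ℕ} (h : ∀ j ∈ J, M ∣ x j - r) :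
    M ∣ altSumInt x J - (J.card % 2 : ℕ) * r := by
  induction J using Finset.induction_on_max with
  | empty => simp [altSumInt]
  | insert m J hm ih =>
    have ih := ih fun j hj => h j (mem_insert_of_mem hj)
    have h0 := dvd_sub (h m (mem_insert_self m J)) ih
    rw [altSumInt_insert x m J hm, card_insert_of_lt hm]
    suffices e : (x m : ℤ) - altSumInt x J - ((J.card + 1) % 2 : ℕ) * r =
        x m - r - (altSumInt x J - (J.card % 2 : ℕ) * r) from e ▸ h0
    obtain h1 | h1 := Nat.mod_two_eq_zero_or_one J.card
    · rw [h1, Nat.succ_mod_two_eq_one_iff.2 h1]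
      push_cast
      ring
    · rw [h1, Nat.succ_mod_two_eq_zero_iff.2 h1]
      push_cast
      ring

/-- An even number of terms congruent modulo `2 ^ (e + 1)` has alternating sum of valuation
larger than `e`. -/
theorem lt_padicValNat_altSum (hx : IsSeq x) {e : ℕ} {r : ℤ} {J : Finset ℕ} (hJ : J.Nonempty)
    (hJ' : Even J.card) (h : ∀ j ∈ J, (2 : ℤ) ^ (e + 1) ∣ x j - r) :
    e < padicValNat 2 (altSum x J) := by
  have h1 := dvd_altSumInt_sub h
  rw [Nat.even_iff.1 hJ', ← (altSum_cast hx hJ).1] at h1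
  rw [← Nat.succ_le_iff, ← padicValNat_dvd_iff_le (altSum_cast hx hJ).2.ne']
  have h2 : (2 : ℤ) ^ (e + 1) ∣ altSum x J := by simpa using h1
  exact_mod_cast h2

theorem two_pow_dvd_sub {a b : ℕ} (ha : 0 < a) (hb : 0 < b)
    (h : padicValNat 2 a = padicValNat 2 b) : (2 : ℤ) ^ (padicValNat 2 b + 1) ∣ a - b := by
  obtain ⟨c, hc⟩ := pow_padicValNat_dvd (p := 2) (n := a)
  obtain ⟨d, hd⟩ := pow_padicValNat_dvd (p := 2) (n := b)
  have hc' := pow_succ_padicValNat_not_dvd (p := 2) ha.ne'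
  have hd' := pow_succ_padicValNat_not_dvd (p := 2) hb.ne'
  rw [h] at hc hc'
  generalize padicValNat 2 b = e at *
  subst hc hd
  rw [pow_succ, mul_dvd_mul_iff_left (by positivity)] at hc' hd'
  push_cast
  rw [pow_succ, ← mul_sub]
  refine mul_dvd_mul_left _ ?_
  omega

theorem not_follows_padicValNat (hk : 2 ≤ k) (hk_even : Even k) (hx : IsSeq x) {p : Pattern}
    (hp : p ≠ .byMin) : ¬ Follows k (padicValNat 2) x p := by
  -- If the valuations of the terms are distinct, they tend to infinity, and the sums over
  -- `insert m (range (k - 1))` for large `m` have the valuation of the sum over `range (k - 1)`.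
  have key : Rainbow (padicValNat 2) (Set.range x) → ∃ e N, ∀ m, N ≤ m →
      (insert m (range (k - 1))).card = k ∧
      (insert m (range (k - 1))).max = (m : WithBot ℕ) ∧ e < padicValNat 2 (x m) ∧
      padicValNat 2 (altSum x (insert m (range (k - 1)))) = e := by
    intro hr
    have hinj : Function.Injective fun i => padicValNat 2 (x i) := fun i j hij =>
      hx.1.injective (hr ⟨i, rfl⟩ ⟨j, rfl⟩ hij)
    obtain ⟨N, hN⟩ := eventually_atTop.1 (hinj.nat_tendsto_atTop.eventually_gt_atTop
      (padicValNat 2 (altSum x (range (k - 1)))))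
    refine ⟨padicValNat 2 (altSum x (range (k - 1))), max N (k - 1), fun m hm => ?_⟩
    have hlt := range_lt (show k - 1 ≤ m by omega)
    have hpos := altSum_cast hx (J := range (k - 1)) ⟨0, mem_range.2 (by omega)⟩
    have hNm := hN m (by omega)
    refine ⟨by rw [card_insert_of_lt hlt, card_range]; omega, max_insert_of_lt hlt, hNm, ?_⟩
    refine padicValNat_two_eq (altSum_cast hx (insert_nonempty _ _)).2 hpos.2
      (a := -altSum x (range (k - 1))) ?_ (Or.inr rfl)
    rw [altSum_insert hx hlt, ← hpos.1]
    have : 2 ^ (padicValNat 2 (altSum x (range (k - 1))) + 1) ∣ x m :=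
      (padicValNat_dvd_iff_le (hx.2 m).ne').2 hNm
    have : ((2 ^ (padicValNat 2 (altSum x (range (k - 1))) + 1) : ℕ) : ℤ) ∣ x m :=
      Int.natCast_dvd_natCast.2 this
    simpa using this
  cases p with
  | mono =>
    intro h
    have h1 := lt_padicValNat_altSum hx (J := range k) ⟨0, mem_range.2 (by omega)⟩
      (by rwa [card_range]) fun j _ => two_pow_dvd_sub (hx.2 j) (hx.2 0)
        (h _ (Or.inl ⟨j, rfl⟩) _ (Or.inl ⟨0, rfl⟩))
    rw [h _ (Or.inr ⟨range k, card_range k, rfl⟩) _ (Or.inl ⟨0, rfl⟩)] at h1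
    exact lt_irrefl _ h1
  | rainbow =>
    intro h
    obtain ⟨e, N, he⟩ := key (h.mono Set.subset_union_left)
    obtain ⟨c1, -, -, v1⟩ := he (max N (k - 1)) (by omega)
    obtain ⟨c2, -, -, v2⟩ := he (max N (k - 1) + 1) (by omega)
    have h1 := h (Or.inr ⟨_, c1, rfl⟩) (Or.inr ⟨_, c2, rfl⟩) (v1.trans v2.symm)
    have h2 := altSum_insert hx (range_lt (show k - 1 ≤ max N (k - 1) by omega))
    have h3 := altSum_insert hx (range_lt (show k - 1 ≤ max N (k - 1) + 1 by omega))
    have h4 := hx.1 (Nat.lt_succ_self (max N (k - 1)))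
    simp only [Nat.succ_eq_add_one] at h4
    omega
  | byMax =>
    intro h
    obtain ⟨e, N, he⟩ := key h.1
    obtain ⟨c1, m1, l1, v1⟩ := he N le_rfl
    rw [h.2 _ c1 N m1] at v1
    omega
  | byMin => exact absurd rfl hp
  | byMinMax =>
    intro h
    obtain ⟨e, N, he⟩ := key h.1
    obtain ⟨c1, m1, -, v1⟩ := he N le_rfl
    obtain ⟨c2, m2, -, v2⟩ := he (N + 1) (by omega)
    have := ((h.2.2 _ _ c2 c1).1 (v1.trans v2.symm)).2
    rw [m1, m2] at this
    exact absurd (WithBot.coe_inj.1 this) (Nat.succ_ne_self N)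

/-- Infinitely many terms of a sequence of integers agree modulo `M`. -/
theorem exists_strictMono_dvd_sub (x : ℕ → ℕ) (M : ℕ) (hM : 0 < M) (n : ℕ) :
    ∃ ψ : ℕ → ℕ, StrictMono ψ ∧ (∀ i, n ≤ ψ i) ∧ ∀ i j, (M : ℤ) ∣ x (ψ i) - x (ψ j) := by
  obtain ⟨r, hr⟩ := Finite.exists_infinite_fiber fun i => (⟨x i % M, Nat.mod_lt _ hM⟩ : Fin M)
  have hr := Nat.frequently_atTop_iff_infinite.2 (Set.infinite_coe_iff.1 hr)
  obtain ⟨ψ, hψ, h⟩ := extraction_of_frequently_atTop (hr.and_eventually (eventually_ge_atTop n))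
  refine ⟨ψ, hψ, fun i => (h i).2, fun i j => ?_⟩
  have hi := Fin.val_eq_of_eq (show _ = r from (h i).1)
  have hj := Fin.val_eq_of_eq (show _ = r from (h j).1)
  exact (Nat.modEq_iff_dvd.1 (show x (ψ j) ≡ x (ψ i) [MOD M] from hj.trans hi.symm))

theorem not_follows_pair (hk : 4 ≤ k) (hk_even : Even k) (hx : IsSeq x) {p : Pattern}
    (hp : p ≠ .byMinMax) :
    ¬ Follows k (fun n => Nat.pair (padicValNat 2 n) (Nat.log 2 n)) x p := by
  have hm : ¬ Monochromatic (fun n => Nat.pair (padicValNat 2 n) (Nat.log 2 n)) (Set.range x) :=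
    fun h => not_monochromatic_log hx fun a ha b hb => (Nat.pair_eq_pair.1 (h a ha b hb)).2
  -- Two further terms that agree modulo a large power of `2` do not affect the valuation `e` of
  -- the alternating sum over `range (k - 2)`.
  have hK := altSum_cast hx (J := range (k - 2)) ⟨0, mem_range.2 (by omega)⟩
  obtain ⟨e, he⟩ : ∃ e, e = padicValNat 2 (altSum x (range (k - 2))) := ⟨_, rfl⟩
  obtain ⟨ψ, hψ, hψk, hdvd⟩ := exists_strictMono_dvd_sub x (2 ^ (e + 1)) (by positivity) (k - 2)
  push_cast at hdvd
  have hlt : ∀ a, ∀ j ∈ range (k - 2), j < ψ a := fun a => range_lt (hψk a)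
  have hlt' : ∀ a b, a < b → ∀ j ∈ insert (ψ a) (range (k - 2)), j < ψ b := fun a b hab =>
    lt_of_mem_insert (hlt a) (hψ hab)
  have hcard : ∀ a b, a < b → (insert (ψ b) (insert (ψ a) (range (k - 2)))).card = k := by
    intro a b hab
    rw [card_insert_of_lt (hlt' a b hab), card_insert_of_lt (hlt a), card_range]
    omega
  have hval : ∀ a b, a < b →
      padicValNat 2 (altSum x (insert (ψ b) (insert (ψ a) (range (k - 2))))) = e := by
    intro a b hab
    rw [he]
    refine padicValNat_two_eq (altSum_cast hx (insert_nonempty _ _)).2 hK.2 ?_ (Or.inl rfl)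
    rw [altSum_insert hx (hlt' a b hab), altSumInt_insert x _ _ (hlt a), ← he, ← hK.1]
    convert hdvd b a using 1
    ring
  cases p with
  | mono => exact fun h => hm fun a ha b hb => h a (Or.inl ha) b (Or.inl hb)
  | rainbow =>
    intro h
    -- Two of the sums with second largest index `ψ 0`, `ψ 1`, `ψ 2` share their logarithm.
    obtain ⟨b, hb⟩ : ∃ b, b = 2 * x (ψ 3) := ⟨_, rfl⟩
    have hb3 : 3 < b := by
      have h1 : ψ 3 ≤ x (ψ 3) := hx.1.le_apply
      have h2 : 3 ≤ ψ 3 := hψ.le_apply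
      omega
    have hlog := fun a ha => log_altSum_insert hx (hlt' a 3 ha) (hb.ge.trans hψ.le_apply)
    have hne : ∀ a a', a < a' → a' < 3 →
        Nat.log 2 (altSum x (insert (ψ b) (insert (ψ a) (range (k - 2))))) ≠
          Nat.log 2 (altSum x (insert (ψ b) (insert (ψ a') (range (k - 2))))) := by
      intro a a' haa ha' hl
      refine altSum_insert_insert_ne hx (hψ haa).ne (hlt a) (hlt a') (hψ (by omega))
        (hψ (by omega)) (h (Or.inr ⟨_, hcard a b (by omega), rfl⟩)
          (Or.inr ⟨_, hcard a' b (by omega), rfl⟩) ?_)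
      exact Nat.pair_eq_pair.2
        ⟨(hval a b (by omega)).trans (hval a' b (by omega)).symm, hl⟩
    have l0 := hlog 0 (by omega)
    have l1 := hlog 1 (by omega)
    have l2 := hlog 2 (by omega)
    have e1 := hne 0 1 (by omega) (by omega)
    have e2 := hne 0 2 (by omega) (by omega)
    have e3 := hne 1 2 (by omega) (by omega)
    omega
  | byMax =>
    rintro ⟨-, h⟩
    -- Both sums below have last index `ψ k`, but the second one has a larger valuation.
    have h1 := (Nat.pair_eq_pair.1 (h _ (hcard 0 k (by omega)) (ψ k)
      (max_insert_of_lt (hlt' 0 k (by omega))))).1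
    have hlt2 : ∀ j ∈ (Ico 1 k).image ψ, j < ψ k := by
      intro j hj
      obtain ⟨i, hi, rfl⟩ := mem_image.1 hj
      exact hψ (mem_Ico.1 hi).2
    have hc : (insert (ψ k) ((Ico 1 k).image ψ)).card = k := by
      rw [card_insert_of_lt hlt2, card_image_of_injective _ hψ.injective, Nat.card_Ico]
      omega
    have h2 := (Nat.pair_eq_pair.1 (h _ hc (ψ k) (max_insert_of_lt hlt2))).1
    have h3 := lt_padicValNat_altSum hx (insert_nonempty _ _) (by rwa [hc])
      (e := e) (r := x (ψ 0)) (J := insert (ψ k) ((Ico 1 k).image ψ)) (by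
        intro j hj
        obtain rfl | hj := mem_insert.1 hj
        · exact hdvd _ _
        · obtain ⟨i, -, rfl⟩ := mem_image.1 hj
          exact hdvd _ _)
    rw [hval 0 k (by omega)] at h1
    omega
  | byMin => exact fun h => hm h.1
  | byMinMax => exact absurd rfl hp

/-! ### Two-term sums -/

theorem eq_of_card_two {I J : Finset ℕ} (hI : I.card = 2) (hJ : J.card = 2)
    (hmin : I.min = J.min) (hmax : I.max = J.max) : I = J := by
  have key : ∀ {I : Finset ℕ}, I.card = 2 → ∃ a b, I = insert b {a} ∧
      I.min = (a : WithTop ℕ) ∧ I.max = (b : WithBot ℕ) := by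
    intro I hI
    obtain ⟨b, hb⟩ := max_of_nonempty (card_pos.1 (by omega : 0 < I.card))
    obtain ⟨I, hIb, hbI, rfl⟩ := subset_range_of_mem_max hb
    rw [card_insert_of_notMem hbI] at hI
    obtain ⟨a, rfl⟩ := card_eq_one.1 (by omega : I.card = 1)
    exact ⟨a, b, rfl, (min_insert_last hIb (singleton_nonempty a)).trans min_singleton, hb⟩
  obtain ⟨a, b, rfl, ha, hb⟩ := key hI
  obtain ⟨c, d, rfl, hc, hd⟩ := key hJ
  rw [ha, hc] at hmin
  rw [hb, hd] at hmax
  obtain rfl : a = c := WithTop.coe_inj.1 hmin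
  obtain rfl : b = d := WithBot.coe_inj.1 hmax
  rfl

/-- Both sides say that the terms and the alternating sums, as a family, have distinct colors. -/
theorem follows_two_byMinMax_iff {Δ : ℕ → ℕ} (hx : IsSeq x) :
    Follows 2 Δ x .byMinMax ↔ Follows 2 Δ x .rainbow ∧ PairwiseDistinct 2 x := by
  constructor
  · rintro ⟨hr, hd, hiff⟩
    rw [← Set.disjoint_iff_inter_eq_empty, Set.disjoint_left] at hd
    have hinj : ∀ I J : Finset ℕ, I.card = 2 → J.card = 2 →
        Δ (altSum x I) = Δ (altSum x J) → I = J := fun I J hI hJ e =>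
      (eq_of_card_two hJ hI ((hiff J I hJ hI).1 e).1 ((hiff J I hJ hI).1 e).2).symm
    refine ⟨?_, ?_⟩
    · rintro _ (⟨i, rfl⟩ | ⟨I, hI, rfl⟩) _ (⟨j, rfl⟩ | ⟨J, hJ, rfl⟩) e
      · exact hr ⟨i, rfl⟩ ⟨j, rfl⟩ e
      · exact absurd ⟨_, ⟨J, hJ, rfl⟩, e.symm⟩ (hd ⟨_, ⟨i, rfl⟩, rfl⟩)
      · exact absurd ⟨_, ⟨I, hI, rfl⟩, e⟩ (hd ⟨_, ⟨j, rfl⟩, rfl⟩)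
      · rw [hinj I J hI hJ e]
    · rintro (i | I) (j | J) e <;> simp only [Sum.elim_inl, Sum.elim_inr] at e
      · rw [hx.1.injective e]
      · exact absurd ⟨_, ⟨J, J.2, rfl⟩, congrArg Δ e.symm⟩ (hd ⟨_, ⟨i, rfl⟩, rfl⟩)
      · exact absurd ⟨_, ⟨I, I.2, rfl⟩, congrArg Δ e⟩ (hd ⟨_, ⟨j, rfl⟩, rfl⟩)
      · rw [Subtype.ext (hinj I J I.2 J.2 (congrArg Δ e))]
  · rintro ⟨hr, hd⟩
    refine ⟨hr.mono Set.subset_union_left, ?_, fun I J hI hJ => ⟨fun e => ?_, fun e => ?_⟩⟩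
    · rw [← Set.disjoint_iff_inter_eq_empty, Set.disjoint_left]
      rintro _ ⟨_, ⟨i, rfl⟩, rfl⟩ ⟨_, ⟨J, hJ, rfl⟩, e⟩
      have e' := hr (Or.inr ⟨J, hJ, rfl⟩) (Or.inl ⟨i, rfl⟩) e
      have := @hd (Sum.inr ⟨J, hJ⟩) (Sum.inl i) e'
      simp at this
    · have e' := hr (Or.inr ⟨J, hJ, rfl⟩) (Or.inr ⟨I, hI, rfl⟩) e
      have := @hd (Sum.inr ⟨J, hJ⟩) (Sum.inr ⟨I, hI⟩) e'
      simp only [Sum.inr.injEq, Subtype.mk.injEq] at this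
      rw [this]
      exact ⟨rfl, rfl⟩
    · rw [eq_of_card_two hI hJ e.1 e.2]

/-! ### Minimality of the list of patterns -/

/-- For each pattern there is a coloring for which no sequence follows any other pattern; for
`k = 2` the pattern `byMinMax` has to be left out. -/
theorem exists_coloring_not_follows (hk : 2 ≤ k) (hk_even : Even k) (p : Pattern)
    (hp : p = .byMinMax → 4 ≤ k) : ∃ Δ : ℕ → ℕ, ∀ x, IsSeq x → ∀ q, q ≠ p →
      (q = .byMinMax → 4 ≤ k) → ¬ Follows k Δ x q := by
  cases p with
  | mono => exact ⟨_, fun x hx q hq _ => not_follows_const hx hq⟩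
  | rainbow => exact ⟨_, fun x hx q hq hq' => not_follows_id hk hx hq hq'⟩
  | byMax => exact ⟨_, fun x hx q hq _ => not_follows_log hk hx hq⟩
  | byMin => exact ⟨_, fun x hx q hq _ => not_follows_padicValNat hk hk_even hx hq⟩
  | byMinMax => exact ⟨_, fun x hx q hq _ => not_follows_pair (hp rfl) hk_even hx hq⟩

end Colorings

end AltSum

theorem theorem4p2 (k : ℕ) (hk : 2 ≤ k) (hk_even : Even k) :
    (∀ Δ : ℕ → ℕ, ∃ x : ℕ → ℕ, AltSum.IsSeq x ∧ AltSum.PairwiseDistinct k x ∧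
      ∃ p : AltSum.Pattern, AltSum.Follows k Δ x p) ∧
    (4 ≤ k → ∀ p : AltSum.Pattern, ¬ AltSum.Unavoidable k {q | q ≠ p}) ∧
    (k = 2 →
      (∀ (Δ : ℕ → ℕ) (x : ℕ → ℕ), AltSum.IsSeq x →
        (AltSum.Follows k Δ x .byMinMax ↔
          AltSum.Follows k Δ x .rainbow ∧ AltSum.PairwiseDistinct k x)) ∧
      ∀ p : AltSum.Pattern, p ≠ .byMinMax →
        ¬ AltSum.Unavoidable k {q | q ≠ .byMinMax ∧ q ≠ p}) := by
  refine ⟨AltSum.exists_follows hk hk_even, fun hk4 p h => ?_, ?_⟩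
  · obtain ⟨Δ, hΔ⟩ := AltSum.exists_coloring_not_follows hk hk_even p fun _ => hk4
    obtain ⟨x, hx, q, hq, hf⟩ := h Δ
    exact hΔ x hx q hq (fun _ => hk4) hf
  · rintro rfl
    refine ⟨fun Δ x hx => AltSum.follows_two_byMinMax_iff hx, fun p hp h => ?_⟩
    obtain ⟨Δ, hΔ⟩ := AltSum.exists_coloring_not_follows hk hk_even p fun e => absurd e hp
    obtain ⟨x, hx, q, hq, hf⟩ := h Δ
    exact hΔ x hx q hq.2 (fun e => absurd e hq.1) hf
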